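/- Let $\mathbb{X}$ be a compact metric space, $\mu$ a finite Borel measure on $\mathbb{X}$ and $T\in\mathbb{R}$. Let $\xi=(\xi(x))_{x\in\mathbb{X}}$ be a real-valued Gaussian process with continuous sample paths on a probability space $(\Omega,\mathcal{F},\mathbb{P})$, let $\tau:\mathbb{X}\to[0,\infty)$ be continuous, and let $(U_n)_{n\ge1}$ be i.i.d. $\mathcal{N}(0,1)$ random variables, independent of $\xi$. A sequence $(X_n)_{n\ge1}$ of $\mathbb{X}$-valued random variables, with observations $Z_n=\xi(X_n)+\tau(X_n)U_n$ and $\mathcal{F}_n=\sigma(X_1,Z_1,\dots,X_n,Z_n)$, is a sequential design if $X_n$ is $\mathcal{F}_{n-1}$-measurable for every $n\ge1$. Let $\mathbb{P}_n^\xi$ denote the (regular) conditional distribution of $\xi$, as a random element of $C(\mathbb{X})$, given $\mathcal{F}_n$, and $p_n(u)=\mathbb{P}_n^\xi(\{f: f(u)\ge T\})$. For a probability measure $\nu$ on $C(\mathbb{X})$ put $p_\nu(u)=\nu(\{f:f(u)\ge T\})$ and define the integrated Bernoulli variance $\mathcal{H}(\nu)=\int_{\mathbb{X}}p_\nu(1-p_\nu)\,d\mu$.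 For $x\in\mathbb{X}$ put $$\mathcal{J}_x(\nu)=\mathbb{E}\big[\mathcal{H}\big(\mathrm{Cond}_{x,\,f(x)+\tau(x)U}(\nu)\big)\big],$$ where $f\sim\nu$ and $U\sim\mathcal{N}(0,1)$ are independent and $\mathrm{Cond}_{x,z}(\nu)$ is the conditional distribution of $f$ given $f(x)+\tau(x)U=z$. Let $J_n(x)=\mathcal{J}_x(\mathbb{P}_n^\xi)$. The sequential design is called quasi-SUR (associated with $\mathcal{H}$) if there are positive reals $\varepsilon_n\to0$ and an integer $n_0$ such that, for all $n\ge n_0$, $J_n(X_{n+1})\le\inf_{x\in\mathbb{X}}J_n(x)+\varepsilon_n$ almost surely. Then, for any quasi-SUR sequential design associated with $\mathcal{H}$, as $n\to\infty$, almost surely and in $L^1(\mathbb{P})$, $$\int_{\mathbb{X}}\big(\mathbf{1}_{\xi(u)\ge T}-p_n(u)\big)^2\,d\mu(u)\to0 \qquad\text{and}\qquad \int_{\mathbb{X}}\big(\mathbf{1}_{\xi(u)\ge T}-\mathbf{1}_{p_n(u)\ge1/2}\big)^2\,d\mu(u)\to0 .$$ -/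

import Mathlib

open MeasureTheory ProbabilityTheory Filter Topology
open scoped ENNReal

namespace SUR

noncomputable section

/-- `C(𝕏, ℝ)`, with the topology of uniform convergence, carries its Borel σ-algebra. -/
instance instMeasurableSpacePaths {𝕏 : Type*} [TopologicalSpace 𝕏] :
    MeasurableSpace C(𝕏, ℝ) := borel _

instance instBorelSpacePaths {𝕏 : Type*} [TopologicalSpace 𝕏] : BorelSpace C(𝕏, ℝ) := ⟨rfl⟩

section Definitions

variable {𝕏 Ω : Type*} [MetricSpace 𝕏] [CompactSpace 𝕏]

/-- The excursion set `Γ(f) = {u | f(u) ≥ T}`. -/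
def excursionSet (T : ℝ) (f : 𝕏 → ℝ) : Set 𝕏 := {u | T ≤ f u}

/-- The coverage (excursion) probability `p_ν(u) = ν {f | f(u) ≥ T}` of a law `ν` on `C(𝕏, ℝ)`. -/
def coverProb (T : ℝ) (ν : Measure C(𝕏, ℝ)) (u : 𝕏) : ℝ≥0∞ := ν {f | u ∈ excursionSet T f}

/-- The integrated Bernoulli variance `H(ν) = ∫ p_ν (1 - p_ν) dμ`. -/
def bernoulliVariance [MeasurableSpace 𝕏] (μ : Measure 𝕏) (T : ℝ) (ν : Measure C(𝕏, ℝ)) : ℝ≥0∞ :=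
  ∫⁻ u, coverProb T ν u * (1 - coverProb T ν u) ∂μ

/-- `Cond_{x,z}(ν)`: the (regular) conditional distribution of `f` given `f(x) + τ(x) u = z`, where
`f ∼ ν` and `u ∼ N(0, 1)` are independent. -/
def condAt (τ : 𝕏 → ℝ) (ν : Measure C(𝕏, ℝ)) [IsFiniteMeasure ν] (x : 𝕏) : Kernel ℝ C(𝕏, ℝ) :=
  condDistrib (fun q : C(𝕏, ℝ) × ℝ => q.1) (fun q : C(𝕏, ℝ) × ℝ => q.1 x + τ x * q.2)
    (ν.prod (gaussianReal 0 1))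

/-- The expected residual uncertainty `J_x(ν) = ∬ H(Cond_{x, f(x) + τ(x) u}(ν)) ν(df) φ(u) du`
when the next observation is made at `x`. -/
def criterion (τ : 𝕏 → ℝ) (H : Measure C(𝕏, ℝ) → ℝ≥0∞) (ν : Measure C(𝕏, ℝ)) [IsFiniteMeasure ν]
    (x : 𝕏) : ℝ≥0∞ :=
  ∫⁻ q, H (condAt τ ν x (q.1 x + τ x * q.2)) ∂(ν.prod (gaussianReal 0 1))

/-- The noisy observation made at the `n`-th design point. All sequences are indexed from `0`:
`X n`, `U n`, `obs τ ξ U X n` stand for `X_{n+1}`, `U_{n+1}`, `Z_{n+1}`. -/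
def obs (τ : 𝕏 → ℝ) (ξ : Ω → C(𝕏, ℝ)) (U : ℕ → Ω → ℝ) (X : ℕ → Ω → 𝕏) (n : ℕ) (ω : Ω) : ℝ :=
  ξ ω (X n ω) + τ (X n ω) * U n ω

/-- The first `n` design points and observations. -/
def history (τ : 𝕏 → ℝ) (ξ : Ω → C(𝕏, ℝ)) (U : ℕ → Ω → ℝ) (X : ℕ → Ω → 𝕏) (n : ℕ) (ω : Ω) :
    Fin n → 𝕏 × ℝ :=
  fun i => (X i ω, obs τ ξ U X i ω)

variable [MeasurableSpace 𝕏]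

/-- The σ-algebra `F_n` generated by the first `n` design points and observations. -/
abbrev obsSigma (τ : 𝕏 → ℝ) (ξ : Ω → C(𝕏, ℝ)) (U : ℕ → Ω → ℝ) (X : ℕ → Ω → 𝕏) (n : ℕ) :
    MeasurableSpace Ω :=
  MeasurableSpace.comap (history τ ξ U X n) inferInstance

/-- A (non-randomized) sequential design: each design point is a measurable function of the
previous design points and observations. -/
def IsSequentialDesign (τ : 𝕏 → ℝ) (ξ : Ω → C(𝕏, ℝ)) (U : ℕ → Ω → ℝ) (X : ℕ → Ω → 𝕏) : Prop :=
  ∀ n, Measurable[obsSigma τ ξ U X n] (X n)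

variable [MeasurableSpace Ω]

/-- The posterior `P_n^ξ`: the (regular) conditional distribution of `ξ` given the first `n` design
points and observations. -/
def posterior (P : Measure Ω) [IsFiniteMeasure P] (τ : 𝕏 → ℝ) (ξ : Ω → C(𝕏, ℝ)) (U : ℕ → Ω → ℝ)
    (X : ℕ → Ω → 𝕏) (n : ℕ) (ω : Ω) : Measure C(𝕏, ℝ) :=
  condDistrib ξ (history τ ξ U X n) P (history τ ξ U X n ω)

instance instIsProbabilityMeasurePosterior (P : Measure Ω) [IsFiniteMeasure P] (τ : 𝕏 → ℝ)
    (ξ : Ω → C(𝕏, ℝ)) (U : ℕ → Ω → ℝ) (X : ℕ → Ω → 𝕏) (n : ℕ) (ω : Ω) :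
    IsProbabilityMeasure (posterior P τ ξ U X n ω) := by
  unfold posterior; infer_instance

/-- A quasi-SUR sequential design associated with the uncertainty functional `H`: for some positive
sequence `ε_n → 0`, one has `J_n(X_{n+1}) ≤ inf J_n + ε_n` for all large `n`. (Posteriors being
defined up to null sets, the inequality is required almost surely.) -/
def IsQuasiSUR (P : Measure Ω) [IsFiniteMeasure P] (τ : 𝕏 → ℝ) (ξ : Ω → C(𝕏, ℝ)) (U : ℕ → Ω → ℝ)
    (H : Measure C(𝕏, ℝ) → ℝ≥0∞) (X : ℕ → Ω → 𝕏) : Prop :=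
  IsSequentialDesign τ ξ U X ∧
    ∃ ε : ℕ → ℝ, (∀ n, 0 < ε n) ∧ Tendsto ε atTop (𝓝 0) ∧
      ∃ n₀ : ℕ, ∀ n ≥ n₀, ∀ᵐ ω ∂P,
        criterion τ H (posterior P τ ξ U X n ω) (X n ω) ≤
          (⨅ x, criterion τ H (posterior P τ ξ U X n ω) x) + ENNReal.ofReal (ε n)

/-- `p_n(u)`, the conditional probability of `ξ(u) ≥ T` given the first `n` observations. -/
def postProb (P : Measure Ω) [IsFiniteMeasure P] (τ : 𝕏 → ℝ) (ξ : Ω → C(𝕏, ℝ)) (U : ℕ → Ω → ℝ)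
    (X : ℕ → Ω → 𝕏) (T : ℝ) (n : ℕ) (ω : Ω) (u : 𝕏) : ℝ :=
  (coverProb T (posterior P τ ξ U X n ω) u).toReal

/-- `∫ (1_{ξ(u) ≥ T} - p_n(u))² μ(du)`. -/
def softError (P : Measure Ω) [IsFiniteMeasure P] (μ : Measure 𝕏) (τ : 𝕏 → ℝ) (ξ : Ω → C(𝕏, ℝ))
    (U : ℕ → Ω → ℝ) (X : ℕ → Ω → 𝕏) (T : ℝ) (n : ℕ) (ω : Ω) : ℝ :=
  ∫ u, ((excursionSet T (ξ ω)).indicator (fun _ => (1 : ℝ)) u - postProb P τ ξ U X T n ω u) ^ 2 ∂μ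

/-- `∫ (1_{ξ(u) ≥ T} - 1_{p_n(u) ≥ 1/2})² μ(du)`. -/
def plugInError (P : Measure Ω) [IsFiniteMeasure P] (μ : Measure 𝕏) (τ : 𝕏 → ℝ) (ξ : Ω → C(𝕏, ℝ))
    (U : ℕ → Ω → ℝ) (X : ℕ → Ω → 𝕏) (T : ℝ) (n : ℕ) (ω : Ω) : ℝ :=
  ∫ u, ((excursionSet T (ξ ω)).indicator (fun _ => (1 : ℝ)) u -
    {v | 1 / 2 ≤ postProb P τ ξ U X T n ω v}.indicator (fun _ => (1 : ℝ)) u) ^ 2 ∂μ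

/-- The random variables `I n` converge to `0` almost surely and in `L¹(P)`. -/
def TendstoZeroAEAndL1 (P : Measure Ω) (I : ℕ → Ω → ℝ) : Prop :=
  (∀ᵐ ω ∂P, Tendsto (fun n => I n ω) atTop (𝓝 0)) ∧
    (∀ n, Integrable (I n) P) ∧ Tendsto (fun n => ∫ ω, |I n ω| ∂P) atTop (𝓝 0)

end Definitions

end

end SUR

/-!
Write `Γ_u` for the event `ξ(u) ≥ T` and `p_n(u)` for its conditional probability given the first
`n` observations. The mean uncertainty `E[H(P_n)]` decreases to a limit, because the next
posterior is on average no more uncertain than the one-step criterion predicts, and the criterion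
never exceeds the present uncertainty. For a quasi-SUR design the criterion at the chosen point
is, up to `ε_n`, at most the criterion at any fixed point `x`. Hence the mean gain that an
observation at `x` would bring tends to `0`, for every fixed `x`
(`tendsto_lintegral_residualCov`).

By the law of total variance, this gain bounds from above the integral over `u` of the squared
covariance of `1_{Γ_u}` with `exp(i t Z)`, for every real `t`, where `Z` is the noisy observation
at `x`. The noise is independent of the path and its characteristic function does not vanish, so
the covariance with `exp(i t ξ(x))` is controlled too (`criterion_add_lintegral_excursionCov_le`).
Averaging over the past and using Lévy's theorem `p_n(u) → p_∞(u)`, one obtains for each `x` and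
`t` that `E[(1_{Γ_u} - p_∞(u)) exp(i t ξ(x))] = 0` for almost every `u`. The left side is
continuous in `(x, t)`, so the null set of exceptional `u` can be chosen independently of `(x,
t)`, and one may take `x = u`. Uniqueness of characteristic functions then forces `p_∞(u) =
1_{Γ_u}` almost surely (`ae_eq_indicator_of_forall_integral_exp_eq_zero`). Fubini's theorem and
dominated convergence turn this into the convergence of both errors.

Posteriors and conditional laws are only determined up to null sets, and `condAt` is chosen
separately for each law and point. The comparison of the criterion with the next posterior
(`lintegral_bernoulliVariance_posterior_succ_le`) therefore uses a jointly measurable version of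
`condAt`, and it compares the two as forecasts: the Bernoulli variance of a law is the least mean
quadratic loss among all forecasts of the excursion set, attained by the coverage function.
-/

namespace SUR

/-! ### Measurability of path functionals -/

section Measurability

variable {𝕏 α : Type*} [MetricSpace 𝕏]

lemma measurable_eval_const (x : 𝕏) : Measurable fun f : C(𝕏, ℝ) => f x :=
  (continuous_eval_const x).measurable

lemma measurableSet_setOf_mem_excursionSet (T : ℝ) (u : 𝕏) :
    MeasurableSet {f : C(𝕏, ℝ) | u ∈ excursionSet T f} :=
  measurableSet_le measurable_const (measurable_eval_const u)

lemma coverProb_le_one (T : ℝ) (ν : Measure C(𝕏, ℝ)) [IsProbabilityMeasure ν] (u : 𝕏) :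
    coverProb T ν u ≤ 1 := prob_le_one

lemma bernoulliVariance_le [MeasurableSpace 𝕏] (μ : Measure 𝕏) (T : ℝ) (ν : Measure C(𝕏, ℝ))
    [IsProbabilityMeasure ν] : bernoulliVariance μ T ν ≤ μ Set.univ := by
  calc bernoulliVariance μ T ν ≤ ∫⁻ _, 1 ∂μ :=
        lintegral_mono fun u => mul_le_one' (coverProb_le_one T ν u) tsub_le_self
    _ = μ Set.univ := by simp

variable [CompactSpace 𝕏] [MeasurableSpace α]

/-- A `C(𝕏, ℝ)`-valued map all of whose coordinates are measurable is Borel measurable: evaluation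
along a dense sequence is a continuous injection into a countable product of lines, hence a
measurable embedding by the Lusin-Souslin theorem. -/
lemma measurable_of_measurable_eval {f : α → C(𝕏, ℝ)} (hf : ∀ x, Measurable fun a => f a x) :
    Measurable f := by
  obtain ⟨D, hDc, hD⟩ := TopologicalSpace.exists_countable_dense 𝕏
  have : Countable D := hDc.to_subtype
  let e : C(𝕏, ℝ) → D → ℝ := fun g x => g x
  have hec : Continuous e := continuous_pi fun x => continuous_eval_const (x : 𝕏)
  have hei : Function.Injective e := by
    intro g h hgh
    refine DFunLike.coe_injective (Continuous.ext_on hD g.continuous h.continuous ?_)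
    exact fun x hx => congrFun hgh ⟨x, hx⟩
  exact (hec.measurableEmbedding hei).measurable_comp_iff.1
    (measurable_pi_lambda _ fun x => hf x)

variable [MeasurableSpace 𝕏] [BorelSpace 𝕏]

lemma measurable_eval : Measurable fun q : C(𝕏, ℝ) × 𝕏 => q.1 q.2 :=
  continuous_eval.measurable

lemma measurableSet_excursion_prod (T : ℝ) :
    MeasurableSet {q : C(𝕏, ℝ) × 𝕏 | q.2 ∈ excursionSet T q.1} :=
  measurableSet_le measurable_const measurable_eval

lemma measurable_coverProb_kernel (T : ℝ) (η : Kernel α C(𝕏, ℝ)) [IsSFiniteKernel η] :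
    Measurable fun q : α × 𝕏 => coverProb T (η q.1) q.2 := by
  have h : MeasurableSet {q : (α × 𝕏) × C(𝕏, ℝ) | q.1.2 ∈ excursionSet T q.2} :=
    (measurable_snd.prodMk (measurable_snd.comp measurable_fst)) (measurableSet_excursion_prod T)
  exact Kernel.measurable_kernel_prodMk_left (κ := η.comap Prod.fst measurable_fst) h

lemma measurable_coverProb (T : ℝ) (ν : Measure C(𝕏, ℝ)) [SFinite ν] :
    Measurable (coverProb T ν) :=
  (measurable_coverProb_kernel T (Kernel.const Unit ν)).comp
    (measurable_const.prodMk measurable_id : Measurable fun u : 𝕏 => ((), u))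

end Measurability

/-! ### The Brier loss -/

section Brier

variable {𝕏 α : Type*} [MetricSpace 𝕏] [CompactSpace 𝕏] [MeasurableSpace α]
  [MeasurableSpace 𝕏]

/-- The integrated quadratic loss `∫ (1_{f(u) ≥ T} - Q(u))² μ(du)` of a `[0, 1]`-valued forecast `Q`
of the excursion set of `f`. -/
noncomputable def brierLoss (μ : Measure 𝕏) (T : ℝ) (Q : 𝕏 → ℝ≥0∞) (f : C(𝕏, ℝ)) : ℝ≥0∞ :=
  open scoped Classical in
  ∫⁻ u, (if u ∈ excursionSet T f then (1 - Q u) ^ 2 else Q u ^ 2) ∂μ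

lemma mul_one_sub_le_brier {p q : ℝ≥0∞} (hp : p ≤ 1) (hq : q ≤ 1) :
    p * (1 - p) ≤ p * (1 - q) ^ 2 + (1 - p) * q ^ 2 := by
  lift p to NNReal using (hp.trans_lt ENNReal.one_lt_top).ne
  lift q to NNReal using (hq.trans_lt ENNReal.one_lt_top).ne
  norm_cast at *
  rw [← NNReal.coe_le_coe]
  push_cast [NNReal.coe_sub hp, NNReal.coe_sub hq]
  nlinarith [sq_nonneg ((p : ℝ) - q)]

lemma mul_one_sub_eq_brier {p : ℝ≥0∞} (hp : p ≤ 1) :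
    p * (1 - p) = p * (1 - p) ^ 2 + (1 - p) * p ^ 2 := by
  calc p * (1 - p) = p * (1 - p) * ((1 - p) + p) := by rw [tsub_add_cancel_of_le hp, mul_one]
    _ = _ := by ring

variable [BorelSpace 𝕏] {μ : Measure 𝕏} [SFinite μ]

lemma measurable_brierLoss (T : ℝ) {Q : α × 𝕏 → ℝ≥0∞} (hQ : Measurable Q) :
    Measurable fun q : α × C(𝕏, ℝ) => brierLoss μ T (fun u => Q (q.1, u)) q.2 := by
  classical
  have hQ' : Measurable fun q : (α × C(𝕏, ℝ)) × 𝕏 => Q (q.1.1, q.2) :=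
    hQ.comp (by fun_prop)
  have h : MeasurableSet {q : (α × C(𝕏, ℝ)) × 𝕏 | q.2 ∈ excursionSet T q.1.2} :=
    ((measurable_snd.comp measurable_fst).prodMk measurable_snd) (measurableSet_excursion_prod T)
  have hm : Measurable fun q : (α × C(𝕏, ℝ)) × 𝕏 =>
      if q.2 ∈ excursionSet T q.1.2 then (1 - Q (q.1.1, q.2)) ^ 2 else Q (q.1.1, q.2) ^ 2 :=
    Measurable.ite h ((measurable_const.sub hQ').pow_const 2) (hQ'.pow_const 2)
  convert Measurable.lintegral_prod_right' (ν := μ) hm using 2 with q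
  unfold brierLoss
  congr! 3

lemma lintegral_brierLoss (T : ℝ) {Q : 𝕏 → ℝ≥0∞} (hQ : Measurable Q) (ν : Measure C(𝕏, ℝ))
    [IsProbabilityMeasure ν] :
    ∫⁻ f, brierLoss μ T Q f ∂ν =
      ∫⁻ u, (coverProb T ν u * (1 - Q u) ^ 2 + (1 - coverProb T ν u) * Q u ^ 2) ∂μ := by
  classical
  unfold brierLoss
  have h : MeasurableSet {q : C(𝕏, ℝ) × 𝕏 | q.2 ∈ excursionSet T q.1} :=
    measurableSet_excursion_prod T
  have hm : Measurable fun q : C(𝕏, ℝ) × 𝕏 =>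
      if q.2 ∈ excursionSet T q.1 then (1 - Q q.2) ^ 2 else Q q.2 ^ 2 :=
    Measurable.ite h (by fun_prop) (by fun_prop)
  rw [lintegral_lintegral_swap]
  · refine lintegral_congr fun u => ?_
    have hu := measurableSet_setOf_mem_excursionSet T u
    have := lintegral_piecewise (μ := ν) hu (fun _ => (1 - Q u) ^ 2) (fun _ => Q u ^ 2)
    simp only [lintegral_const, Measure.restrict_apply MeasurableSet.univ, Set.univ_inter] at this
    rw [prob_compl_eq_one_sub hu] at this
    rw [coverProb, mul_comm (ν _), mul_comm (1 - ν _), ← this]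
    refine lintegral_congr fun f => ?_
    simp only [Set.piecewise, Set.mem_ofPred_eq]
  · exact hm.aemeasurable

/-- The coverage function is the best forecast: any other one has a larger mean loss than `H(ν)`. -/
lemma bernoulliVariance_le_lintegral_brierLoss (T : ℝ) {Q : 𝕏 → ℝ≥0∞} (hQ : Measurable Q)
    (hQ1 : ∀ u, Q u ≤ 1) (ν : Measure C(𝕏, ℝ)) [IsProbabilityMeasure ν] :
    bernoulliVariance μ T ν ≤ ∫⁻ f, brierLoss μ T Q f ∂ν := by
  rw [lintegral_brierLoss T hQ]
  exact lintegral_mono fun u => mul_one_sub_le_brier (coverProb_le_one T ν u) (hQ1 u)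

lemma lintegral_brierLoss_coverProb (T : ℝ) (ν : Measure C(𝕏, ℝ)) [IsProbabilityMeasure ν] :
    ∫⁻ f, brierLoss μ T (coverProb T ν) f ∂ν = bernoulliVariance μ T ν := by
  rw [lintegral_brierLoss T (measurable_coverProb T ν)]
  exact lintegral_congr fun u => (mul_one_sub_eq_brier (coverProb_le_one T ν u)).symm

end Brier

/-! ### Disintegration of joint laws -/

section Disintegration

variable {Ω β E : Type*} [MeasurableSpace Ω] [MeasurableSpace β] [MeasurableSpace E]
  [StandardBorelSpace E] [Nonempty E] {P : Measure Ω} [IsProbabilityMeasure P]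
  {h : Ω → β} {Y : Ω → E}

lemma lintegral_eq_lintegral_condDistrib (hh : Measurable h) (hY : Measurable Y)
    {F : β × E → ℝ≥0∞} (hF : Measurable F) :
    ∫⁻ ω, F (h ω, Y ω) ∂P = ∫⁻ ω, ∫⁻ y, F (h ω, y) ∂condDistrib Y h P (h ω) ∂P := by
  rw [← lintegral_map (f := F) (g := fun ω => (h ω, Y ω)) hF (hh.prodMk hY),
    ← compProd_map_condDistrib hY.aemeasurable, Measure.lintegral_compProd hF,
    lintegral_map hF.lintegral_kernel_prod_right' hh]

lemma integral_eq_integral_condDistrib (hh : Measurable h) (hY : Measurable Y)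
    {F : β × E → ℂ} (hF : Measurable F) {C : ℝ} (hFC : ∀ x, ‖F x‖ ≤ C) :
    ∫ ω, F (h ω, Y ω) ∂P = ∫ ω, ∫ y, F (h ω, y) ∂condDistrib Y h P (h ω) ∂P := by
  have hi : Integrable F (P.map h ⊗ₘ condDistrib Y h P) := by
    have := Measure.isProbabilityMeasure_map (μ := P) hh.aemeasurable
    exact Integrable.of_bound hF.aestronglyMeasurable C (ae_of_all _ hFC)
  rw [← integral_map (f := F) (φ := fun ω => (h ω, Y ω)) (hh.prodMk hY).aemeasurable
      hF.aestronglyMeasurable,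
    ← compProd_map_condDistrib hY.aemeasurable, Measure.integral_compProd hi,
    integral_map hh.aemeasurable]
  exact (hF.stronglyMeasurable.integral_kernel_prod_right').aestronglyMeasurable

lemma lintegral_eq_lintegral_condDistrib_prod {V : Ω → ℝ} {γ : Measure ℝ} [SFinite γ]
    (hh : Measurable h) (hY : Measurable Y) (hV : HasLaw V γ P)
    (hind : IndepFun (fun ω => (h ω, Y ω)) V P) {F : β × E × ℝ → ℝ≥0∞} (hF : Measurable F) :
    ∫⁻ ω, F (h ω, Y ω, V ω) ∂P =
      ∫⁻ ω, ∫⁻ q, F (h ω, q) ∂((condDistrib Y h P (h ω)).prod γ) ∂P := by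
  have hF' : Measurable fun a : (β × E) × ℝ => F (a.1.1, a.1.2, a.2) := hF.comp (by fun_prop)
  have hlaw := hind.map_prod_eq_prod_map_map (hh.prodMk hY).aemeasurable hV.aemeasurable
  rw [hV.map_eq] at hlaw
  calc ∫⁻ ω, F (h ω, Y ω, V ω) ∂P
      = ∫⁻ a, F (a.1.1, a.1.2, a.2) ∂(P.map fun ω => ((h ω, Y ω), V ω)) := by
        rw [lintegral_map' hF'.aemeasurable ((hh.prodMk hY).aemeasurable.prodMk hV.aemeasurable)]
    _ = ∫⁻ b, ∫⁻ v, F (b.1, b.2, v) ∂γ ∂(P.map fun ω => (h ω, Y ω)) := by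
        rw [hlaw, lintegral_prod _ hF'.aemeasurable]
    _ = ∫⁻ ω, ∫⁻ v, F (h ω, Y ω, v) ∂γ ∂P := by
        rw [lintegral_map hF'.lintegral_prod_right' (hh.prodMk hY)]
    _ = ∫⁻ ω, ∫⁻ y, ∫⁻ v, F (h ω, y, v) ∂γ ∂(condDistrib Y h P (h ω)) ∂P :=
        lintegral_eq_lintegral_condDistrib hh hY
          (F := fun b => ∫⁻ v, F (b.1, b.2, v) ∂γ) hF'.lintegral_prod_right'
    _ = _ := by
        refine lintegral_congr fun ω => ?_
        rw [lintegral_prod (fun q => F (h ω, q)) (hF.comp measurable_prodMk_left).aemeasurable]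

end Disintegration

/-! ### The design and its filtration -/

section Design

variable {𝕏 Ω : Type*} [MetricSpace 𝕏] [MeasurableSpace 𝕏]
  {τ : 𝕏 → ℝ} {ξ : Ω → C(𝕏, ℝ)} {U : ℕ → Ω → ℝ} {X : ℕ → Ω → 𝕏}

lemma obsSigma_mono : Monotone (obsSigma τ ξ U X) := by
  intro n k hnk
  have : history τ ξ U X n = (fun a (i : Fin n) => a (Fin.castLE hnk i)) ∘ history τ ξ U X k := rfl
  simp only [obsSigma]
  rw [this, ← MeasurableSpace.comap_comp]
  refine MeasurableSpace.comap_mono ?_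
  exact Measurable.comap_le (measurable_pi_lambda _ fun i => measurable_pi_apply _)

variable [CompactSpace 𝕏] [BorelSpace 𝕏]

/-- The first `n` design points and observations are determined by the path and the first `n`
noises. The σ-algebra `m` is arbitrary, so that this gives both the measurability of the history and
its independence of the later noises. -/
lemma measurable_history {m : MeasurableSpace Ω} (hX : IsSequentialDesign τ ξ U X)
    (hτ : Continuous τ) (hξ : Measurable[m] ξ) {n : ℕ} (hU : ∀ i < n, Measurable[m] (U i)) :
    Measurable[m] (history τ ξ U X n) := by
  have key : ∀ k, (∀ j < k, Measurable[m] (X j)) → k ≤ n →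
      Measurable[m] (history τ ξ U X k) := by
    intro k hk hkn
    refine measurable_pi_lambda _ fun i => ?_
    have hXi := hk i i.2
    have hobs : Measurable[m] (obs τ ξ U X i) :=
      (measurable_eval.comp (hξ.prodMk hXi)).add
        ((hτ.measurable.comp hXi).mul (hU i (i.2.trans_le hkn)))
    exact hXi.prodMk hobs
  have hXm : ∀ k < n, Measurable[m] (X k) := by
    intro k
    induction k using Nat.strong_induction_on with
    | _ k ih =>
      intro hkn
      exact (hX k).mono (key k (fun j hj => ih j hj (hj.trans hkn)) hkn.le).comap_le le_rfl
  exact key n hXm le_rfl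

variable [MeasurableSpace Ω] {P : Measure Ω} [IsProbabilityMeasure P]

/-- The noise of the next observation is independent of the path together with the past. -/
lemma indepFun_history_noise (hX : IsSequentialDesign τ ξ U X) (hτ : Continuous τ)
    (hξ : Measurable ξ) (hU : ∀ n, Measurable (U n)) (hU_indep : iIndepFun U P)
    (hξU : IndepFun ξ (fun ω n => U n ω) P) (n : ℕ) :
    IndepFun (fun ω => (history τ ξ U X n ω, ξ ω)) (U n) P := by
  let V : Ω → Fin n → ℝ := fun ω i => U i ω
  have hV : Measurable V := measurable_pi_lambda _ fun i => hU i
  have hVU : IndepFun V (U n) P := by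
    have h := hU_indep.indepFun_finset (Finset.range n) {n} (by simp) hU
    have hn : Measurable fun a : ({n} : Finset ℕ) → ℝ => a ⟨n, Finset.mem_singleton_self n⟩ :=
      measurable_pi_apply _
    exact h.comp (φ := fun a (i : Fin n) => a ⟨i, Finset.mem_range.2 i.2⟩)
      (ψ := fun a => a ⟨n, Finset.mem_singleton_self n⟩)
      (measurable_pi_lambda _ fun i => measurable_pi_apply _) hn
  have hξVU : IndepFun ξ (fun ω => (V ω, U n ω)) P :=
    hξU.comp (φ := id) (ψ := fun a : ℕ → ℝ => ((fun i : Fin n => a i), a n)) measurable_id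
      (by fun_prop)
  have hξV : IndepFun ξ V P := hξVU.comp measurable_id measurable_fst
  have hind : IndepFun (fun ω => (ξ ω, V ω)) (U n) P := by
    rw [indepFun_iff_map_prod_eq_prod_map_map (hξ.prodMk hV).aemeasurable (hU n).aemeasurable,
      hξV.map_prod_eq_prod_map_map hξ.aemeasurable hV.aemeasurable]
    apply MeasurableEquiv.prodAssoc.map_measurableEquiv_injective
    rw [Measure.prodAssoc_prod, Measure.map_map MeasurableEquiv.prodAssoc.measurable
        ((hξ.prodMk hV).prodMk (hU n)),
      ← hVU.map_prod_eq_prod_map_map hV.aemeasurable (hU n).aemeasurable,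
      ← hξVU.map_prod_eq_prod_map_map hξ.aemeasurable (hV.prodMk (hU n)).aemeasurable]
    rfl
  have hle : MeasurableSpace.comap (fun ω => (history τ ξ U X n ω, ξ ω)) inferInstance ≤
      MeasurableSpace.comap (fun ω => (ξ ω, V ω)) inferInstance := by
    have hpair : Measurable[MeasurableSpace.comap (fun ω => (ξ ω, V ω)) inferInstance]
        fun ω => (ξ ω, V ω) := comap_measurable _
    have hξ' := measurable_fst.comp hpair
    refine Measurable.comap_le (Measurable.prodMk (measurable_history hX hτ hξ' fun i hi => ?_) hξ')
    exact (measurable_pi_apply (⟨i, hi⟩ : Fin n)).comp (measurable_snd.comp hpair)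
  exact indep_of_indep_of_le_left hind hle

/-- The canonical filtration of the design. -/
def obsFiltration (hX : IsSequentialDesign τ ξ U X) (hτ : Continuous τ)
    (hξ : Measurable ξ) (hU : ∀ n, Measurable (U n)) :
    Filtration ℕ (inferInstance : MeasurableSpace Ω) where
  seq := obsSigma τ ξ U X
  mono' := obsSigma_mono
  le' _ := (measurable_history hX hτ hξ fun i _ => hU i).comap_le

end Design

/-! ### One-step lookahead -/

section Lookahead

variable {𝕏 Ω β : Type*} [MetricSpace 𝕏] [CompactSpace 𝕏] [MeasurableSpace 𝕏] [BorelSpace 𝕏]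
  [MeasurableSpace β] {τ : 𝕏 → ℝ}

/-- A jointly measurable version of `condAt`: the conditional laws `Cond_{x,z}(ν)` are chosen
separately for each `ν` and `x`, but when `ν` and `x` depend measurably on a parameter, they agree
almost everywhere with a kernel in the parameter and `z`. -/
lemma exists_kernel_ae_eq_condAt (hτ : Continuous τ) (K : Kernel β C(𝕏, ℝ)) [IsMarkovKernel K]
    {g : β → 𝕏} (hg : Measurable g) :
    ∃ η : Kernel (β × ℝ) C(𝕏, ℝ), IsMarkovKernel η ∧ ∀ b,
      ∀ᵐ q ∂((K b).prod (gaussianReal 0 1)),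
        condAt τ (K b) (g b) (q.1 (g b) + τ (g b) * q.2) =
          η (b, q.1 (g b) + τ (g b) * q.2) := by
  let Z : β × C(𝕏, ℝ) × ℝ → ℝ := fun a => a.2.1 (g a.1) + τ (g a.1) * a.2.2
  have hZ : Measurable Z :=
    (measurable_eval.comp
      (by fun_prop : Measurable fun a : β × C(𝕏, ℝ) × ℝ => (a.2.1, g a.1))).add
      ((hτ.measurable.comp (by fun_prop)).mul (by fun_prop))
  let κ : Kernel β (ℝ × C(𝕏, ℝ)) :=
    (Kernel.id ×ₖ (K ×ₖ Kernel.const β (gaussianReal 0 1))).map fun a => (Z a, a.2.1)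
  have hκ : ∀ b, κ b = ((K b).prod (gaussianReal 0 1)).map fun q => (Z (b, q), q.1) := by
    intro b
    simp only [κ]
    rw [Kernel.map_apply _ (by fun_prop), Kernel.prod_apply, Kernel.prod_apply, Kernel.id_apply,
      Kernel.const_apply, Measure.dirac_prod, Measure.map_map (by fun_prop) (by fun_prop)]
    rfl
  have : IsMarkovKernel κ := Kernel.IsMarkovKernel.map _ (by fun_prop)
  refine ⟨Kernel.condKernel κ, inferInstance, fun b => ?_⟩
  have h : ∀ (ρ : Measure (ℝ × C(𝕏, ℝ))) [IsFiniteMeasure ρ], κ b = ρ →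
      (fun z => Kernel.condKernel κ (b, z)) =ᵐ[ρ.fst] ρ.condKernel := by
    rintro ρ _ rfl
    exact Kernel.condKernel_apply_eq_condKernel κ b
  replace h := h _ (hκ b)
  rw [Measure.fst_map_prodMk measurable_fst] at h
  have hZb : Measurable fun q => Z (b, q) := hZ.comp measurable_prodMk_left
  filter_upwards [ae_of_ae_map hZb.aemeasurable h] with q hq
  rw [condAt, condDistrib]
  exact hq.symm

end Lookahead

section LookaheadMean

variable {𝕏 Ω : Type*} [MetricSpace 𝕏] [CompactSpace 𝕏] [MeasurableSpace 𝕏] [BorelSpace 𝕏]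
  [MeasurableSpace Ω] {τ : 𝕏 → ℝ} {ξ : Ω → C(𝕏, ℝ)} {U : ℕ → Ω → ℝ} {X : ℕ → Ω → 𝕏}
  {P : Measure Ω} [IsProbabilityMeasure P]

/-- On average, the uncertainty left after the next observation is at most the value of the
criterion at the next design point. The forecast that is plugged into the Brier loss at time `n + 1`
is the coverage function of the one-step update of the posterior at time `n`. -/
lemma lintegral_bernoulliVariance_posterior_succ_le (μ : Measure 𝕏) [SFinite μ] (T : ℝ)
    (hX : IsSequentialDesign τ ξ U X) (hτ : Continuous τ)
    (hξ : Measurable ξ) (hU : ∀ n, Measurable (U n))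
    (hU_law : ∀ n, HasLaw (U n) (gaussianReal 0 1) P) (hU_indep : iIndepFun U P)
    (hξU : IndepFun ξ (fun ω n => U n ω) P) (n : ℕ) :
    ∫⁻ ω, bernoulliVariance μ T (posterior P τ ξ U X (n + 1) ω) ∂P ≤
      ∫⁻ ω, criterion τ (bernoulliVariance μ T) (posterior P τ ξ U X n ω) (X n ω) ∂P := by
  have hh := measurable_history hX hτ hξ (fun i (_ : i < n) => hU i)
  have hh' := measurable_history hX hτ hξ (fun i (_ : i < n + 1) => hU i)
  have : Nonempty 𝕏 := P.nonempty_of_neZero.map (X n)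
  obtain ⟨g, hg, hXg⟩ := (hX n).exists_eq_measurable_comp
  obtain ⟨η, hη, hηc⟩ := exists_kernel_ae_eq_condAt hτ
    (condDistrib ξ (history τ ξ U X n) P) hg
  set K := condDistrib ξ (history τ ξ U X n) P
  let Z : (Fin n → 𝕏 × ℝ) × C(𝕏, ℝ) × ℝ → ℝ := fun a => a.2.1 (g a.1) + τ (g a.1) * a.2.2
  have hZ : Measurable Z :=
    (measurable_eval.comp
      (by fun_prop : Measurable fun a : (Fin n → 𝕏 × ℝ) × C(𝕏, ℝ) × ℝ => (a.2.1, g a.1))).add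
      ((hτ.measurable.comp (by fun_prop)).mul (by fun_prop))
  have hQ : Measurable fun a : ((Fin n → 𝕏 × ℝ) × ℝ) × 𝕏 => coverProb T (η a.1) a.2 :=
    measurable_coverProb_kernel T η
  have hB : Measurable fun q : ((Fin n → 𝕏 × ℝ) × ℝ) × C(𝕏, ℝ) =>
      brierLoss μ T (coverProb T (η q.1)) q.2 := measurable_brierLoss T hQ
  -- The criterion is the mean Brier loss of the updated coverage function.
  have hcrit : ∀ b, criterion τ (bernoulliVariance μ T) (K b) (g b) =
      ∫⁻ q, brierLoss μ T (coverProb T (η (b, Z (b, q)))) q.1 ∂((K b).prod (gaussianReal 0 1)) := by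
    intro b
    have hZb : Measurable fun q => Z (b, q) := hZ.comp measurable_prodMk_left
    have hd := lintegral_eq_lintegral_condDistrib (P := (K b).prod (gaussianReal 0 1))
      (h := fun q => Z (b, q)) (Y := Prod.fst) hZb measurable_fst
      (F := fun q => brierLoss μ T (coverProb T (η (b, q.1))) q.2)
      (hB.comp (by fun_prop : Measurable fun q : ℝ × C(𝕏, ℝ) => ((b, q.1), q.2)))
    rw [hd, criterion]
    refine lintegral_congr_ae ?_
    filter_upwards [hηc b] with q hq
    have hq' : condDistrib Prod.fst (fun q => Z (b, q)) ((K b).prod (gaussianReal 0 1)) (Z (b, q))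
      = η (b, Z (b, q)) := hq
    rw [hq, hq', lintegral_brierLoss_coverProb]
  -- The past and the last observation are functions of the enlarged history.
  let r : (Fin (n + 1) → 𝕏 × ℝ) → (Fin n → 𝕏 × ℝ) × ℝ :=
    fun a => (fun i => a i.castSucc, (a (Fin.last n)).2)
  have hr : Measurable r := by fun_prop
  have hrh : ∀ ω, r (history τ ξ U X (n + 1) ω) =
      (history τ ξ U X n ω, Z (history τ ξ U X n ω, ξ ω, U n ω)) := by
    intro ω
    have : X n ω = g (history τ ξ U X n ω) := congrFun hXg ω
    refine Prod.ext rfl ?_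
    simp only [r, history, obs, Z, Fin.val_last]
    rw [this]
  calc ∫⁻ ω, bernoulliVariance μ T (posterior P τ ξ U X (n + 1) ω) ∂P
      ≤ ∫⁻ ω, ∫⁻ f, brierLoss μ T (coverProb T (η (r (history τ ξ U X (n + 1) ω)))) f
          ∂(posterior P τ ξ U X (n + 1) ω) ∂P :=
        lintegral_mono fun ω => bernoulliVariance_le_lintegral_brierLoss T
          (measurable_coverProb T _) (coverProb_le_one T _) _
    _ = ∫⁻ ω, brierLoss μ T (coverProb T (η (r (history τ ξ U X (n + 1) ω)))) (ξ ω) ∂P :=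
        (lintegral_eq_lintegral_condDistrib hh' hξ
          (F := fun q => brierLoss μ T (coverProb T (η (r q.1))) q.2)
          (hB.comp (by fun_prop : Measurable fun q : (Fin (n + 1) → 𝕏 × ℝ) × C(𝕏, ℝ) =>
            (r q.1, q.2)))).symm
    _ = ∫⁻ ω, ∫⁻ q, brierLoss μ T
          (coverProb T (η (history τ ξ U X n ω, Z (history τ ξ U X n ω, q)))) q.1
          ∂((K (history τ ξ U X n ω)).prod (gaussianReal 0 1)) ∂P := by
        simp_rw [hrh]
        exact lintegral_eq_lintegral_condDistrib_prod hh hξ (hU_law n)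
          (indepFun_history_noise hX hτ hξ hU hU_indep hξU n)
          (F := fun a => brierLoss μ T (coverProb T (η (a.1, Z a))) a.2.1)
          (hB.comp ((measurable_fst.prodMk hZ).prodMk (by fun_prop)))
    _ = ∫⁻ ω, criterion τ (bernoulliVariance μ T) (posterior P τ ξ U X n ω) (X n ω) ∂P := by
        refine lintegral_congr fun ω => ?_
        rw [← hcrit, hXg]
        rfl

end LookaheadMean

/-! ### The gain of one observation -/

section Gain

variable {𝕏 : Type*} [MetricSpace 𝕏] [CompactSpace 𝕏] {τ : 𝕏 → ℝ}

/-- If `g` is a `[0, 1]`-valued conditional probability with mean `c`, the mean conditional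
Bernoulli variance falls short of `c (1 - c)` by at least the squared covariance of `g` with any
function bounded by `1`. -/
lemma integral_mul_one_sub_add_sq_norm_le {α : Type*} [MeasurableSpace α] {m : Measure α}
    [IsProbabilityMeasure m] {g : α → ℝ} (hg : Measurable g) (hg0 : ∀ a, 0 ≤ g a)
    (hg1 : ∀ a, g a ≤ 1) {φ : α → ℂ} (hφ1 : ∀ a, ‖φ a‖ ≤ 1) {c : ℝ} (hc : ∫ a, g a ∂m = c) :
    ∫ a, g a * (1 - g a) ∂m + ‖∫ a, ((g a - c : ℝ) : ℂ) * φ a ∂m‖ ^ 2 ≤ c * (1 - c) := by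
  have hb : ∀ {f : α → ℝ}, Measurable f → (∃ C, ∀ a, ‖f a‖ ≤ C) → Integrable f m :=
    fun hf ⟨C, hC⟩ => Integrable.of_bound hf.aestronglyMeasurable C (ae_of_all _ hC)
  have hgn : ∀ a, ‖g a‖ ≤ 1 := fun a => by
    rw [Real.norm_eq_abs, abs_le]; exact ⟨by linarith [hg0 a], hg1 a⟩
  have hi1 : Integrable g m := hb hg ⟨1, hgn⟩
  have hgc : ∀ a, |g a - c| ≤ 1 + |c| := fun a => by
    have := abs_sub (g a) c
    have := hgn a
    rw [Real.norm_eq_abs] at this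
    linarith
  have hi2 : Integrable (fun a => (g a - c) ^ 2) m := by
    refine hb (by fun_prop) ⟨(1 + |c|) ^ 2, fun a => ?_⟩
    rw [norm_pow]
    exact pow_le_pow_left₀ (norm_nonneg _) (hgc a) 2
  have hi3 : Integrable (fun a => |g a - c|) m :=
    hb (by fun_prop) ⟨1 + |c|, fun a => by simpa using hgc a⟩
  have h1 : ‖∫ a, ((g a - c : ℝ) : ℂ) * φ a ∂m‖ ≤ ∫ a, |g a - c| ∂m := by
    refine norm_integral_le_of_norm_le hi3 (ae_of_all _ fun a => ?_)
    rw [norm_mul, Complex.norm_real, Real.norm_eq_abs]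
    exact mul_le_of_le_one_right (abs_nonneg _) (hφ1 a)
  -- Jensen's inequality, from expanding `(|g - c| - s) ^ 2 ≥ 0` with `s` the mean of `|g - c|`.
  have h2 : (∫ a, |g a - c| ∂m) ^ 2 ≤ ∫ a, (g a - c) ^ 2 ∂m := by
    set s := ∫ a, |g a - c| ∂m with hs
    have h : ∫ a, (2 * s * |g a - c| - s ^ 2) ∂m ≤ ∫ a, (g a - c) ^ 2 ∂m := by
      refine integral_mono ((hi3.const_mul _).sub (integrable_const _)) hi2 fun a => ?_
      have := sq_nonneg (|g a - c| - s)
      have := sq_abs (g a - c)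
      simp only
      nlinarith
    rw [integral_sub (hi3.const_mul _) (integrable_const _), integral_const_mul, ← hs] at h
    simp at h
    nlinarith
  have h3 : ∫ a, g a * (1 - g a) ∂m + ∫ a, (g a - c) ^ 2 ∂m = c * (1 - c) := by
    have hi4 : Integrable (fun a => g a * (1 - g a)) m := by
      refine hb (by fun_prop) ⟨1, fun a => ?_⟩
      rw [Real.norm_eq_abs, abs_le]
      constructor <;> nlinarith [hg0 a, hg1 a]
    rw [← integral_add hi4 hi2]
    have : ∀ a, g a * (1 - g a) + (g a - c) ^ 2 = (1 - 2 * c) * g a + c ^ 2 := fun a => by ring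
    simp_rw [this]
    rw [integral_add (hi1.const_mul _) (integrable_const _), integral_const_mul, hc]
    simp
    ring
  have h4 : ‖∫ a, ((g a - c : ℝ) : ℂ) * φ a ∂m‖ ^ 2 ≤ (∫ a, |g a - c| ∂m) ^ 2 :=
    pow_le_pow_left₀ (norm_nonneg _) h1 2
  linarith

/-- The covariance, under the law `ν` of a path `f`, of the indicator of `f(u) ≥ T` with
`exp(i t f(x))`. -/
noncomputable def excursionCov (T : ℝ) (ν : Measure C(𝕏, ℝ)) (u x : 𝕏) (t : ℝ) : ℂ :=
  ∫ f, (({f : C(𝕏, ℝ) | u ∈ excursionSet T f}.indicator (fun _ => (1 : ℝ)) f -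
    (coverProb T ν u).toReal : ℝ) : ℂ) * Complex.exp (t * f x * Complex.I) ∂ν

lemma sq_norm_charFun_gaussianReal (t : ℝ) :
    ‖charFun (gaussianReal 0 1) t‖ ^ 2 = Real.exp (-t ^ 2) := by
  have : (t * (0 : ℝ) * Complex.I - ((1 : NNReal) : ℝ) * t ^ 2 / 2 : ℂ) =
      ((-t ^ 2 / 2 : ℝ) : ℂ) := by
    push_cast; ring
  rw [charFun_gaussianReal, this, Complex.norm_exp_ofReal, ← Real.exp_nat_mul]
  congr 1
  push_cast
  ring

/-- Bernoulli variance at a single `u`: the mean of the variance left after an observation at `x`,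
plus the damped squared covariance, is at most the present variance. Integrating out the noise of
the observation turns `exp(i t Z)` into `exp(i t f(x))` times the characteristic function of the
noise, which never vanishes. -/
lemma integral_condAt_mul_one_sub_add_le (T : ℝ) (ν : Measure C(𝕏, ℝ)) [IsProbabilityMeasure ν]
    (u x : 𝕏) (t : ℝ) :
    ∫⁻ q, coverProb T (condAt τ ν x (q.1 x + τ x * q.2)) u *
        (1 - coverProb T (condAt τ ν x (q.1 x + τ x * q.2)) u) ∂(ν.prod (gaussianReal 0 1)) +
      ENNReal.ofReal (Real.exp (-(t * τ x) ^ 2)) * ‖excursionCov T ν u x t‖ₑ ^ 2 ≤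
    coverProb T ν u * (1 - coverProb T ν u) := by
  set ρ := ν.prod (gaussianReal 0 1) with hρ
  let A : Set C(𝕏, ℝ) := {f | u ∈ excursionSet T f}
  have hA : MeasurableSet A := measurableSet_setOf_mem_excursionSet T u
  let Z : C(𝕏, ℝ) × ℝ → ℝ := fun q => q.1 x + τ x * q.2
  have hx : Measurable fun f : C(𝕏, ℝ) => f x := measurable_eval_const x
  have hZ : Measurable Z := (hx.comp measurable_fst).add (by fun_prop)
  have : IsMarkovKernel (condAt τ ν x) := by unfold condAt; infer_instance
  let G : ℝ → ℝ := fun z => (condAt τ ν x z).real A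
  have hG : Measurable G := (Kernel.measurable_coe _ hA).ennreal_toReal
  let c : ℝ := (ν A).toReal
  let F : ℝ × C(𝕏, ℝ) → ℂ := fun p =>
    ((A.indicator (fun _ => (1 : ℝ)) p.2 - c : ℝ) : ℂ) * Complex.exp (t * p.1 * Complex.I)
  have hind : Measurable (A.indicator fun _ => (1 : ℝ)) := measurable_const.indicator hA
  have hF : Measurable F :=
    (Complex.measurable_ofReal.comp ((hind.comp measurable_snd).sub measurable_const)).mul
      (by fun_prop)
  have hexp : ∀ s : ℝ, ‖Complex.exp (t * s * Complex.I)‖ = 1 := fun s => by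
    rw [← Complex.ofReal_mul, Complex.norm_exp_ofReal_mul_I]
  have hc0 : 0 ≤ c := ENNReal.toReal_nonneg
  have hc1 : c ≤ 1 := by
    simpa using ENNReal.toReal_mono ENNReal.one_ne_top (prob_le_one (μ := ν) (s := A))
  have hF1 : ∀ p, ‖F p‖ ≤ 1 := fun p => by
    simp only [F]
    rw [norm_mul, hexp, mul_one, Complex.norm_real, Real.norm_eq_abs, abs_le]
    by_cases hp : p.2 ∈ A <;> simp [hp] <;> constructor <;> linarith
  -- The mean of the conditional coverage is the coverage.
  have hmean : ∫ q, G (Z q) ∂ρ = c := by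
    have h := lintegral_eq_lintegral_condDistrib (P := ρ) (h := Z) (Y := Prod.fst) hZ measurable_fst
      (F := fun p => A.indicator (fun _ => 1) p.2)
      ((measurable_const.indicator hA).comp measurable_snd)
    have h1 : ∫⁻ q : C(𝕏, ℝ) × ℝ, A.indicator (fun _ => (1 : ℝ≥0∞)) q.1 ∂ρ = ν A := by
      have h2 : Measurable (A.indicator fun _ => (1 : ℝ≥0∞)) := measurable_const.indicator hA
      rw [← lintegral_map (g := Prod.fst) h2 measurable_fst, hρ, Measure.map_fst_prod]
      simp [lintegral_indicator hA]
    simp only at h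
    rw [h1] at h
    simp only [lintegral_indicator hA, lintegral_const, one_mul, Measure.restrict_apply
      MeasurableSet.univ, Set.univ_inter] at h
    simp only [c, G, h]
    exact integral_toReal ((Kernel.measurable_coe _ hA).comp hZ).aemeasurable
      (ae_of_all _ fun q => measure_lt_top _ _)
  -- Conditioning on the observation does not change the covariance with a function of it.
  have hcov : ∫ q, ((G (Z q) - c : ℝ) : ℂ) * Complex.exp (t * Z q * Complex.I) ∂ρ =
      excursionCov T ν u x t * charFun (gaussianReal 0 1) (t * τ x) := by
    have h := integral_eq_integral_condDistrib (P := ρ) (h := Z) (Y := Prod.fst) hZ measurable_fst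
      hF hF1
    have h1 : ∀ z, ∫ f, F (z, f) ∂(condAt τ ν x z) =
        ((G z - c : ℝ) : ℂ) * Complex.exp (t * z * Complex.I) := by
      intro z
      simp only [F]
      rw [integral_mul_const, integral_complex_ofReal, integral_sub
        ((integrable_const _).indicator hA) (integrable_const _), integral_indicator_const _ hA]
      simp [G]
    have h2 : ∫ q, F (Z q, q.1) ∂ρ = ∫ q, ((G (Z q) - c : ℝ) : ℂ) *
        Complex.exp (t * Z q * Complex.I) ∂ρ := by
      rw [h]
      exact integral_congr_ae (ae_of_all _ fun q => h1 (Z q))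
    rw [← h2, charFun_apply_real, excursionCov, hρ, ← integral_prod_mul]
    refine integral_congr_ae (ae_of_all _ fun q => ?_)
    simp only [F, Z, c, A, coverProb]
    rw [mul_assoc _ (Complex.exp _), ← Complex.exp_add]
    congr 2
    push_cast
    ring
  have hG0 : ∀ z, 0 ≤ G z := fun z => measureReal_nonneg
  have hG1 : ∀ z, G z ≤ 1 := fun z => measureReal_le_one
  have hmain := integral_mul_one_sub_add_sq_norm_le (m := ρ) (hG.comp hZ) (fun q => hG0 (Z q))
    (fun q => hG1 (Z q)) (φ := fun q => Complex.exp (t * Z q * Complex.I))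
    (fun q => (hexp (Z q)).le) hmean
  simp only [Function.comp_def] at hmain
  rw [hcov, norm_mul, mul_pow, sq_norm_charFun_gaussianReal] at hmain
  have hprod : ∀ (κ : Measure C(𝕏, ℝ)) [IsProbabilityMeasure κ],
      κ A * (1 - κ A) = ENNReal.ofReal (κ.real A * (1 - κ.real A)) := by
    intro κ _
    rw [ENNReal.ofReal_mul measureReal_nonneg, ENNReal.ofReal_sub _ measureReal_nonneg,
      ofReal_measureReal, ENNReal.ofReal_one]
  have hlhs : ∫⁻ q, coverProb T (condAt τ ν x (q.1 x + τ x * q.2)) u *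
      (1 - coverProb T (condAt τ ν x (q.1 x + τ x * q.2)) u) ∂ρ =
      ENNReal.ofReal (∫ q, G (Z q) * (1 - G (Z q)) ∂ρ) := by
    have hnn : ∀ q, 0 ≤ G (Z q) * (1 - G (Z q)) := fun q =>
      mul_nonneg (hG0 _) (sub_nonneg.2 (hG1 _))
    rw [ofReal_integral_eq_lintegral_ofReal _ (ae_of_all _ hnn)]
    · exact lintegral_congr fun q => hprod (condAt τ ν x (Z q))
    · have hm : Measurable fun q => G (Z q) * (1 - G (Z q)) := by
        have := hG.comp hZ
        exact this.mul (measurable_const.sub this)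
      refine Integrable.of_bound hm.aestronglyMeasurable 1 (ae_of_all _ fun q => ?_)
      rw [Real.norm_eq_abs, abs_le]
      constructor <;> nlinarith [hG0 (Z q), hG1 (Z q)]
  have hcovn : ‖excursionCov T ν u x t‖ₑ ^ 2 = ENNReal.ofReal (‖excursionCov T ν u x t‖ ^ 2) := by
    rw [ENNReal.ofReal_pow (norm_nonneg _), ofReal_norm]
  rw [hlhs, hcovn, ← ENNReal.ofReal_mul (Real.exp_nonneg _), ← ENNReal.ofReal_add
    (integral_nonneg fun q => mul_nonneg (hG0 _) (sub_nonneg.2 (hG1 _))) (by positivity)]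
  calc _ ≤ ENNReal.ofReal (c * (1 - c)) :=
        ENNReal.ofReal_le_ofReal (by rw [mul_comm (Real.exp _)]; exact hmain)
    _ = _ := (hprod ν).symm

/-- An observation at `x` reduces the mean uncertainty by at least the integrated squared covariance
of the excursion indicator with `exp(i t f(x))`, damped by the characteristic function of the
noise. -/
lemma criterion_add_lintegral_excursionCov_le [MeasurableSpace 𝕏] [BorelSpace 𝕏] (μ : Measure 𝕏)
    [SFinite μ] (T : ℝ) (ν : Measure C(𝕏, ℝ)) [IsProbabilityMeasure ν] (x : 𝕏) (t : ℝ) :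
    criterion τ (bernoulliVariance μ T) ν x +
      ENNReal.ofReal (Real.exp (-(t * τ x) ^ 2)) * ∫⁻ u, ‖excursionCov T ν u x t‖ₑ ^ 2 ∂μ ≤
    bernoulliVariance μ T ν := by
  have : IsMarkovKernel (condAt τ ν x) := by unfold condAt; infer_instance
  have hZ : Measurable fun q : C(𝕏, ℝ) × ℝ => q.1 x + τ x * q.2 :=
    ((measurable_eval_const x).comp measurable_fst).add (by fun_prop)
  have hp : Measurable fun a : (C(𝕏, ℝ) × ℝ) × 𝕏 =>
      coverProb T (condAt τ ν x (a.1.1 x + τ x * a.1.2)) a.2 :=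
    measurable_coverProb_kernel T ((condAt τ ν x).comap _ hZ)
  rw [criterion]
  unfold bernoulliVariance
  rw [lintegral_lintegral_swap (hp.mul (measurable_const.sub hp)).aemeasurable]
  calc _ ≤ _ := add_le_add_right (lintegral_const_mul_le _ _) _
    _ ≤ _ := le_lintegral_add _ _
    _ ≤ _ := lintegral_mono fun u => integral_condAt_mul_one_sub_add_le T ν u x t

end Gain

/-! ### Identification of an event from characteristic functions -/

section Identification

variable {Ω : Type*} [MeasurableSpace Ω] {P : Measure Ω} [IsProbabilityMeasure P]

lemma norm_exp_mul_mul_I (t s : ℝ) : ‖Complex.exp (t * s * Complex.I)‖ = 1 := by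
  rw [← Complex.ofReal_mul, Complex.norm_exp_ofReal_mul_I]

/-- If `1_{Y ∈ B} - p` is orthogonal to all characters of `Y`, for some `[0, 1]`-valued `p`, then
`p = 1_{Y ∈ B}`: the measures `1_{Y ∈ B} P` and `p P` have the same image under `Y`, and comparing
the masses of `B` and of the whole line leaves no room for any other value of `p`. -/
lemma ae_eq_indicator_of_forall_integral_exp_eq_zero {Y : Ω → ℝ} (hY : Measurable Y) {B : Set ℝ}
    (hB : MeasurableSet B) {p : Ω → ℝ} (hp : Measurable p) (hp0 : ∀ᵐ ω ∂P, 0 ≤ p ω)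
    (hp1 : ∀ᵐ ω ∂P, p ω ≤ 1)
    (h : ∀ t : ℝ, ∫ ω, (((Y ⁻¹' B).indicator (fun _ => (1 : ℝ)) ω - p ω : ℝ) : ℂ) *
      Complex.exp (t * Y ω * Complex.I) ∂P = 0) :
    p =ᵐ[P] (Y ⁻¹' B).indicator fun _ => (1 : ℝ) := by
  have hA : MeasurableSet (Y ⁻¹' B) := hY hB
  have hpi : Integrable p P := by
    refine Integrable.of_bound hp.aestronglyMeasurable 1 ?_
    filter_upwards [hp0, hp1] with ω h0 h1
    rw [Real.norm_eq_abs, abs_le]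
    exact ⟨by linarith, h1⟩
  have hwi : Integrable ((Y ⁻¹' B).indicator fun _ => (1 : ℝ)) P :=
    (integrable_const _).indicator hA
  have hexp : ∀ t : ℝ, Measurable fun ω => Complex.exp (t * Y ω * Complex.I) := by fun_prop
  have hint : ∀ {w : Ω → ℝ}, Integrable w P → ∀ t : ℝ,
      Integrable (fun ω => (w ω : ℂ) * Complex.exp (t * Y ω * Complex.I)) P := by
    intro w hw t
    refine hw.ofReal.mul_bdd (c := 1) (hexp t).aestronglyMeasurable (ae_of_all _ fun ω => ?_)
    exact (norm_exp_mul_mul_I t (Y ω)).le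
  have hfin : IsFiniteMeasure (P.withDensity fun ω => ENNReal.ofReal (p ω)) :=
    isFiniteMeasure_withDensity_ofReal hpi.2
  have hEq : (P.restrict (Y ⁻¹' B)).map Y =
      (P.withDensity fun ω => ENNReal.ofReal (p ω)).map Y := by
    refine Measure.ext_of_charFun (funext fun t => ?_)
    have hm : Measurable fun y : ℝ => Complex.exp (t * y * Complex.I) := by fun_prop
    rw [charFun_apply_real, charFun_apply_real, integral_map hY.aemeasurable
      hm.aestronglyMeasurable, integral_map hY.aemeasurable hm.aestronglyMeasurable,
      integral_withDensity_eq_integral_toReal_smul (by fun_prop)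
        (ae_of_all _ fun _ => ENNReal.ofReal_lt_top), ← integral_indicator hA, ← sub_eq_zero, ← h t,
      ← integral_sub]
    · refine integral_congr_ae ?_
      filter_upwards [hp0] with ω h0
      rw [ENNReal.toReal_ofReal h0]
      by_cases hω : ω ∈ Y ⁻¹' B <;> simp [hω, sub_mul]
    · refine (hint hwi t).congr (ae_of_all _ fun ω => ?_)
      by_cases hω : ω ∈ Y ⁻¹' B <;> simp [hω]
    · refine (hint hpi t).congr ?_
      filter_upwards [hp0] with ω h0
      rw [ENNReal.toReal_ofReal h0, Complex.real_smul]
  have hval : ∀ C : Set ℝ, MeasurableSet C →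
      P.real (Y ⁻¹' C ∩ Y ⁻¹' B) = ∫ ω in Y ⁻¹' C, p ω ∂P := by
    intro C hC
    have h1 := congrArg (fun m => (m C).toReal) hEq
    rw [Measure.map_apply hY hC, Measure.map_apply hY hC, Measure.restrict_apply (hY hC),
      withDensity_apply _ (hY hC)] at h1
    rw [measureReal_def, h1, integral_eq_lintegral_of_nonneg_ae (ae_restrict_of_ae hp0)
      hp.aestronglyMeasurable]
  have hvB := hval B hB
  have hvU := hval Set.univ MeasurableSet.univ
  simp only [Set.inter_self, Set.preimage_univ, Set.univ_inter, Measure.restrict_univ] at hvB hvU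
  have hadd : Integrable (fun ω => (Y ⁻¹' B).indicator (fun _ => (1 : ℝ)) ω + p ω) P :=
    hwi.add hpi
  -- The integrand is `|1_{Y ∈ B} - p|`, written without absolute value.
  have hzero : ∫ ω, ((Y ⁻¹' B).indicator (fun _ => (1 : ℝ)) ω + p ω -
      2 * (Y ⁻¹' B).indicator p ω) ∂P = 0 := by
    rw [integral_sub hadd ((hpi.indicator hA).const_mul 2), integral_add hwi hpi,
      integral_const_mul, integral_indicator_const _ hA, integral_indicator hA, ← hvB, ← hvU]
    simp
    ring
  have hnn : 0 ≤ᵐ[P] fun ω => (Y ⁻¹' B).indicator (fun _ => (1 : ℝ)) ω + p ω -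
      2 * (Y ⁻¹' B).indicator p ω := by
    filter_upwards [hp0, hp1] with ω h0 h1
    by_cases hω : ω ∈ Y ⁻¹' B
    · simp only [Pi.zero_apply, Set.indicator_of_mem hω]; linarith
    · simp only [Pi.zero_apply, Set.indicator_of_notMem hω]; linarith
  have hz := (integral_eq_zero_iff_of_nonneg_ae hnn
    (hadd.sub ((hpi.indicator hA).const_mul 2))).1 hzero
  filter_upwards [hz] with ω hω
  by_cases hmem : ω ∈ Y ⁻¹' B
  · simp only [Pi.zero_apply, Set.indicator_of_mem hmem] at hω ⊢; linarith
  · simp only [Pi.zero_apply, Set.indicator_of_notMem hmem] at hω ⊢; linarith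

lemma enorm_integral_sq_le_lintegral {f : Ω → ℂ} (hf : AEStronglyMeasurable f P) :
    ‖∫ ω, f ω ∂P‖ₑ ^ 2 ≤ ∫⁻ ω, ‖f ω‖ₑ ^ 2 ∂P := by
  have h1 : ‖∫ ω, f ω ∂P‖ₑ ≤ eLpNorm f 1 P := by
    rw [eLpNorm_one_eq_lintegral_enorm]; exact enorm_integral_le_lintegral_enorm _
  have h2 := eLpNorm_le_eLpNorm_of_exponent_le (p := 1) (q := 2) (by norm_num) hf
  have h3 := eLpNorm_nnreal_pow_eq_lintegral (f := f) (μ := P) (p := 2) (by norm_num)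
  simp only [NNReal.coe_ofNat, ENNReal.rpow_ofNat, ENNReal.coe_ofNat] at h3
  rw [← h3]
  gcongr
  exact h1.trans h2

end Identification

/-! ### Quadratic errors -/

/-- Bounded quadratic errors that vanish pointwise in the limit have integrals over `𝕏` that tend
to `0` almost surely and in `L¹`. -/
lemma tendstoZeroAEAndL1_integral_sq {𝕏 Ω : Type*} [MeasurableSpace 𝕏] [MeasurableSpace Ω]
    {P : Measure Ω} [IsProbabilityMeasure P] {μ : Measure 𝕏} [IsFiniteMeasure μ]
    {D : ℕ → Ω × 𝕏 → ℝ} (hD : ∀ n, Measurable (D n)) (hD1 : ∀ n q, |D n q| ≤ 1)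
    (hlim : ∀ᵐ ω ∂P, ∀ᵐ u ∂μ, Tendsto (fun n => D n (ω, u)) atTop (𝓝 0)) :
    TendstoZeroAEAndL1 P fun n ω => ∫ u, D n (ω, u) ^ 2 ∂μ := by
  have hsq : ∀ n q, ‖D n q ^ 2‖ ≤ 1 := fun n q => by
    rw [norm_pow, Real.norm_eq_abs]; exact pow_le_one₀ (abs_nonneg _) (hD1 n q)
  have hbd : ∀ n ω, ‖∫ u, D n (ω, u) ^ 2 ∂μ‖ ≤ μ.real Set.univ := fun n ω => by
    simpa using norm_integral_le_of_norm_le_const (μ := μ) (f := fun u => D n (ω, u) ^ 2) (C := 1)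
      (ae_of_all _ fun u => hsq n (ω, u))
  have hm : ∀ n, AEStronglyMeasurable (fun ω => ∫ u, D n (ω, u) ^ 2 ∂μ) P := fun n =>
    (StronglyMeasurable.integral_prod_right' (ν := μ)
      (f := fun q => D n q ^ 2) ((hD n).pow_const 2).stronglyMeasurable).aestronglyMeasurable
  have hae : ∀ᵐ ω ∂P, Tendsto (fun n => ∫ u, D n (ω, u) ^ 2 ∂μ) atTop (𝓝 0) := by
    filter_upwards [hlim] with ω hω
    have := tendsto_integral_of_dominated_convergence (μ := μ)
      (F := fun n u => D n (ω, u) ^ 2) (f := fun _ => (0 : ℝ)) (fun _ => 1)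
      (fun n => (((hD n).comp measurable_prodMk_left).pow_const 2).aestronglyMeasurable)
      (integrable_const _) (fun n => ae_of_all _ fun u => hsq n (ω, u))
      (by filter_upwards [hω] with u hu; simpa using hu.pow 2)
    simpa using this
  refine ⟨hae, fun n => Integrable.of_bound (hm n) _ (ae_of_all _ (hbd n)), ?_⟩
  have := tendsto_integral_of_dominated_convergence (μ := P)
    (F := fun n ω => |∫ u, D n (ω, u) ^ 2 ∂μ|) (f := fun _ => (0 : ℝ)) (fun _ => μ.real Set.univ)
    (fun n => (hm n).norm)
    (integrable_const _) (fun n => ae_of_all _ fun ω => by simpa using hbd n ω)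
    (by filter_upwards [hae] with ω hω; simpa using hω.abs)
  simpa using this

/-! ### Asymptotics of quasi-SUR designs -/

section Asymptotics

variable {𝕏 Ω : Type*} [MetricSpace 𝕏] [CompactSpace 𝕏] [MeasurableSpace 𝕏]
  [MeasurableSpace Ω] {P : Measure Ω} [IsProbabilityMeasure P] {μ : Measure 𝕏} [IsFiniteMeasure μ]
  {T : ℝ} {τ : 𝕏 → ℝ} {ξ : Ω → C(𝕏, ℝ)} {U : ℕ → Ω → ℝ} {X : ℕ → Ω → 𝕏}

/-- The indicator of `ξ(u) ≥ T` minus its conditional probability given `n` observations. -/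
noncomputable def residual (P : Measure Ω) [IsFiniteMeasure P] (τ : 𝕏 → ℝ) (ξ : Ω → C(𝕏, ℝ))
    (U : ℕ → Ω → ℝ) (X : ℕ → Ω → 𝕏) (T : ℝ) (n : ℕ) (q : Ω × 𝕏) : ℝ :=
  (excursionSet T (ξ q.1)).indicator (fun _ => (1 : ℝ)) q.2 - postProb P τ ξ U X T n q.1 q.2

/-- The covariance of the residual at `u` with `exp(i t ξ(x))`. -/
noncomputable def residualCov (P : Measure Ω) [IsFiniteMeasure P] (τ : 𝕏 → ℝ) (ξ : Ω → C(𝕏, ℝ))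
    (U : ℕ → Ω → ℝ) (X : ℕ → Ω → 𝕏) (T : ℝ) (n : ℕ) (u x : 𝕏) (t : ℝ) : ℂ :=
  ∫ ω, (residual P τ ξ U X T n (ω, u) : ℂ) * Complex.exp (t * ξ ω x * Complex.I) ∂P

/-- The posterior as a kernel on the sample space. -/
lemma exists_kernel_posterior (hh : ∀ n, Measurable (history τ ξ U X n)) (n : ℕ) :
    ∃ κ : Kernel Ω C(𝕏, ℝ), IsMarkovKernel κ ∧ ∀ ω, κ ω = posterior P τ ξ U X n ω :=
  ⟨(condDistrib ξ (history τ ξ U X n) P).comap _ (hh n), inferInstance, fun _ => rfl⟩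

lemma postProb_nonneg (n : ℕ) (ω : Ω) (u : 𝕏) : 0 ≤ postProb P τ ξ U X T n ω u :=
  ENNReal.toReal_nonneg

lemma postProb_le_one (n : ℕ) (ω : Ω) (u : 𝕏) : postProb P τ ξ U X T n ω u ≤ 1 := by
  simpa [postProb] using
    ENNReal.toReal_mono ENNReal.one_ne_top (coverProb_le_one T (posterior P τ ξ U X n ω) u)

lemma abs_residual_le_one (n : ℕ) (q : Ω × 𝕏) : |residual P τ ξ U X T n q| ≤ 1 := by
  have h0 := postProb_nonneg (P := P) (τ := τ) (ξ := ξ) (U := U) (X := X) (T := T) n q.1 q.2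
  have h1 := postProb_le_one (P := P) (τ := τ) (ξ := ξ) (U := U) (X := X) (T := T) n q.1 q.2
  rw [residual, abs_le]
  by_cases h : q.2 ∈ excursionSet T (ξ q.1)
  · simp only [Set.indicator_of_mem h]; constructor <;> linarith
  · simp only [Set.indicator_of_notMem h]; constructor <;> linarith

lemma residualCov_eq_integral_excursionCov (hξ : Measurable ξ)
    (hh : ∀ n, Measurable (history τ ξ U X n)) (n : ℕ) (u x : 𝕏) (t : ℝ) :
    residualCov P τ ξ U X T n u x t =
      ∫ ω, excursionCov T (posterior P τ ξ U X n ω) u x t ∂P := by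
  set K := condDistrib ξ (history τ ξ U X n) P with hK
  have hA : MeasurableSet {f : C(𝕏, ℝ) | u ∈ excursionSet T f} :=
    measurableSet_setOf_mem_excursionSet T u
  have hx : Measurable fun f : C(𝕏, ℝ) => f x := measurable_eval_const x
  have hx' : Measurable fun a : (Fin n → 𝕏 × ℝ) × C(𝕏, ℝ) => a.2 x := hx.comp measurable_snd
  have hp : Measurable fun b => (coverProb T (K b) u).toReal :=
    (Kernel.measurable_coe K hA).ennreal_toReal
  have hF : Measurable fun a : (Fin n → 𝕏 × ℝ) × C(𝕏, ℝ) =>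
      (({f : C(𝕏, ℝ) | u ∈ excursionSet T f}.indicator (fun _ => (1 : ℝ)) a.2 -
        (coverProb T (K a.1) u).toReal : ℝ) : ℂ) * Complex.exp (t * a.2 x * Complex.I) :=
    (Complex.measurable_ofReal.comp (((measurable_const.indicator hA).comp measurable_snd).sub
      (hp.comp measurable_fst))).mul (by fun_prop)
  refine Eq.trans ?_ (integral_eq_integral_condDistrib (hh n) hξ hF (C := 1) fun a => ?_)
  · rfl
  · have h0 : 0 ≤ (coverProb T (K a.1) u).toReal := ENNReal.toReal_nonneg
    have h1 : (coverProb T (K a.1) u).toReal ≤ 1 := by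
      simpa using ENNReal.toReal_mono ENNReal.one_ne_top (coverProb_le_one T (K a.1) u)
    rw [norm_mul, norm_exp_mul_mul_I, mul_one, Complex.norm_real, Real.norm_eq_abs, abs_le]
    by_cases h : a.2 ∈ {f : C(𝕏, ℝ) | u ∈ excursionSet T f}
    · rw [Set.indicator_of_mem h]; constructor <;> linarith
    · rw [Set.indicator_of_notMem h]; constructor <;> linarith

variable [BorelSpace 𝕏]

lemma measurable_indicator_excursionSet (hξ : Measurable ξ) :
    Measurable fun q : Ω × 𝕏 => (excursionSet T (ξ q.1)).indicator (fun _ => (1 : ℝ)) q.2 := by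
  have h : MeasurableSet {q : Ω × 𝕏 | q.2 ∈ excursionSet T (ξ q.1)} :=
    ((hξ.comp measurable_fst).prodMk measurable_snd) (measurableSet_excursion_prod T)
  exact (measurable_const (a := (1 : ℝ))).indicator h

lemma measurable_postProb (hh : ∀ n, Measurable (history τ ξ U X n)) (n : ℕ) :
    Measurable fun q : Ω × 𝕏 => postProb P τ ξ U X T n q.1 q.2 := by
  obtain ⟨κ, _, hκ⟩ := exists_kernel_posterior (P := P) hh n
  simp only [postProb, ← hκ]
  exact (measurable_coverProb_kernel T κ).ennreal_toReal

lemma measurable_residual (hξ : Measurable ξ) (hh : ∀ n, Measurable (history τ ξ U X n)) (n : ℕ) :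
    Measurable (residual P τ ξ U X T n) :=
  (measurable_indicator_excursionSet hξ).sub (measurable_postProb hh n)

lemma measurable_excursionCov_kernel (κ : Kernel Ω C(𝕏, ℝ)) [IsMarkovKernel κ] (x : 𝕏) (t : ℝ) :
    Measurable fun q : Ω × 𝕏 => excursionCov T (κ q.1) q.2 x t := by
  have hi : Measurable fun a : (Ω × 𝕏) × C(𝕏, ℝ) =>
      {f : C(𝕏, ℝ) | a.1.2 ∈ excursionSet T f}.indicator (fun _ => (1 : ℝ)) a.2 := by
    have h : MeasurableSet {a : (Ω × 𝕏) × C(𝕏, ℝ) | a.1.2 ∈ excursionSet T a.2} :=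
      (measurable_snd.prodMk (measurable_snd.comp measurable_fst)) (measurableSet_excursion_prod T)
    exact (measurable_const (a := (1 : ℝ))).indicator h
  have hp : Measurable fun a : (Ω × 𝕏) × C(𝕏, ℝ) => (coverProb T (κ a.1.1) a.1.2).toReal :=
    (measurable_coverProb_kernel T κ).ennreal_toReal.comp measurable_fst
  have hx : Measurable fun a : (Ω × 𝕏) × C(𝕏, ℝ) => a.2 x :=
    (measurable_eval_const x).comp measurable_snd
  have hF : Measurable fun a : (Ω × 𝕏) × C(𝕏, ℝ) =>
      (({f : C(𝕏, ℝ) | a.1.2 ∈ excursionSet T f}.indicator (fun _ => (1 : ℝ)) a.2 -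
        (coverProb T (κ a.1.1) a.1.2).toReal : ℝ) : ℂ) * Complex.exp (t * a.2 x * Complex.I) :=
    (Complex.measurable_ofReal.comp (hi.sub hp)).mul (by fun_prop)
  exact (hF.stronglyMeasurable.integral_kernel_prod_right'
    (κ := κ.comap Prod.fst measurable_fst)).measurable

lemma measurable_residualCov (hξ : Measurable ξ) (hh : ∀ n, Measurable (history τ ξ U X n))
    (n : ℕ) (x : 𝕏) (t : ℝ) : Measurable fun u => residualCov P τ ξ U X T n u x t := by
  have hx : Measurable fun q : 𝕏 × Ω => ξ q.2 x :=
    (measurable_eval_const x).comp (hξ.comp measurable_snd)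
  have hF : Measurable fun q : 𝕏 × Ω => (residual P τ ξ U X T n (q.2, q.1) : ℂ) *
      Complex.exp (t * ξ q.2 x * Complex.I) :=
    (Complex.measurable_ofReal.comp ((measurable_residual hξ hh n).comp measurable_swap)).mul
      (Complex.measurable_exp.comp
        (((Complex.measurable_ofReal.comp hx).const_mul _).mul_const _))
  exact hF.stronglyMeasurable.integral_prod_right'.measurable

lemma lintegral_residualCov_le (hξ : Measurable ξ) (hh : ∀ n, Measurable (history τ ξ U X n))
    (n : ℕ) (x : 𝕏) (t : ℝ) :
    ∫⁻ u, ‖residualCov P τ ξ U X T n u x t‖ₑ ^ 2 ∂μ ≤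
      ∫⁻ ω, ∫⁻ u, ‖excursionCov T (posterior P τ ξ U X n ω) u x t‖ₑ ^ 2 ∂μ ∂P := by
  obtain ⟨κ, _, hκ⟩ := exists_kernel_posterior (P := P) hh n
  have hm := measurable_excursionCov_kernel (T := T) κ x t
  simp only [residualCov_eq_integral_excursionCov hξ hh, ← hκ]
  rw [lintegral_lintegral_swap (hm.enorm.pow_const 2).aemeasurable]
  exact lintegral_mono fun u => enorm_integral_sq_le_lintegral
    (hm.comp measurable_prodMk_right).aestronglyMeasurable

/-- For a quasi-SUR design, no fixed observation point has a residual gain bounded away from zero: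
the mean uncertainties decrease to a limit, so that the gains at the chosen points vanish. -/
lemma tendsto_lintegral_residualCov (hτ : Continuous τ) (hξ : Measurable ξ)
    (hU : ∀ n, Measurable (U n)) (hU_law : ∀ n, HasLaw (U n) (gaussianReal 0 1) P)
    (hU_indep : iIndepFun U P) (hξU : IndepFun ξ (fun ω n => U n ω) P)
    (hX : IsQuasiSUR P τ ξ U (bernoulliVariance μ T) X) (x : 𝕏) (t : ℝ) :
    Tendsto (fun n => ∫⁻ u, ‖residualCov P τ ξ U X T n u x t‖ₑ ^ 2 ∂μ) atTop (𝓝 0) := by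
  obtain ⟨hdes, ε, -, hε, n₀, hsur⟩ := hX
  have hh : ∀ n, Measurable (history τ ξ U X n) := fun n =>
    measurable_history hdes hτ hξ fun i _ => hU i
  let e : ℕ → ℝ≥0∞ := fun n => ∫⁻ ω, bernoulliVariance μ T (posterior P τ ξ U X n ω) ∂P
  let b : ℕ → ℝ≥0∞ := fun n => ∫⁻ u, ‖residualCov P τ ξ U X T n u x t‖ₑ ^ 2 ∂μ
  let C : ℝ≥0∞ := ENNReal.ofReal (Real.exp (-(t * τ x) ^ 2))
  have hC0 : C ≠ 0 := by simp [C, Real.exp_pos]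
  have hCtop : C ≠ ∞ := ENNReal.ofReal_ne_top
  have hsucc : ∀ n, e (n + 1) ≤
      ∫⁻ ω, criterion τ (bernoulliVariance μ T) (posterior P τ ξ U X n ω) (X n ω) ∂P := fun n =>
    lintegral_bernoulliVariance_posterior_succ_le μ T hdes hτ hξ hU hU_law hU_indep hξU n
  have hanti : Antitone e := antitone_nat_of_succ_le fun n => (hsucc n).trans
    (lintegral_mono fun ω => le_self_add.trans
      (criterion_add_lintegral_excursionCov_le μ T (posterior P τ ξ U X n ω) (X n ω) 0))
  have hetop : ∀ n, e n ≠ ∞ := fun n => by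
    refine ne_top_of_le_ne_top (measure_ne_top μ Set.univ) ?_
    calc e n ≤ ∫⁻ _, μ Set.univ ∂P := lintegral_mono fun ω => bernoulliVariance_le μ T _
      _ = μ Set.univ := by simp
  have hstep : ∀ n ≥ n₀, e (n + 1) + C * b n ≤ e n + ENNReal.ofReal (ε n) := by
    intro n hn
    calc e (n + 1) + C * b n
        ≤ ∫⁻ ω, criterion τ (bernoulliVariance μ T) (posterior P τ ξ U X n ω) (X n ω) ∂P +
          ∫⁻ ω, C * ∫⁻ u, ‖excursionCov T (posterior P τ ξ U X n ω) u x t‖ₑ ^ 2 ∂μ ∂P := by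
          refine add_le_add (hsucc n) ?_
          rw [lintegral_const_mul' _ _ hCtop]
          exact mul_le_mul_right (lintegral_residualCov_le hξ hh n x t) C
      _ ≤ ∫⁻ ω, (criterion τ (bernoulliVariance μ T) (posterior P τ ξ U X n ω) (X n ω) +
          C * ∫⁻ u, ‖excursionCov T (posterior P τ ξ U X n ω) u x t‖ₑ ^ 2 ∂μ) ∂P :=
          le_lintegral_add _ _
      _ ≤ ∫⁻ ω, (bernoulliVariance μ T (posterior P τ ξ U X n ω) +
          ENNReal.ofReal (ε n)) ∂P := by
          refine lintegral_mono_ae ?_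
          filter_upwards [hsur n hn] with ω hω
          have hx := hω.trans (add_le_add_left (iInf_le _ x) _)
          refine (add_le_add_left hx _).trans ?_
          rw [add_right_comm]
          exact add_le_add_left (criterion_add_lintegral_excursionCov_le μ T
            (posterior P τ ξ U X n ω) x t) _
      _ = e n + ENNReal.ofReal (ε n) := by
          rw [lintegral_add_right _ measurable_const]
          simp [e]
  have he := tendsto_atTop_iInf hanti
  have hinf : ⨅ n, e n ≠ ∞ := ne_top_of_le_ne_top (hetop 0) (iInf_le _ 0)
  have hdiff : Tendsto (fun n => C⁻¹ * ((e n - e (n + 1)) + ENNReal.ofReal (ε n))) atTop (𝓝 0) := by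
    have h1 := ENNReal.Tendsto.sub he (he.comp (tendsto_add_atTop_nat 1)) (Or.inl hinf)
    have h2 := ENNReal.tendsto_ofReal hε
    have h3 := ENNReal.Tendsto.const_mul (a := C⁻¹) (h1.add h2) (Or.inr (by simpa using hC0))
    simpa using h3
  refine tendsto_of_tendsto_of_tendsto_of_le_of_le' tendsto_const_nhds hdiff
    (Eventually.of_forall fun _ => zero_le) ?_
  filter_upwards [eventually_ge_atTop n₀] with n hn
  have h1 : C * b n ≤ (e n - e (n + 1)) + ENNReal.ofReal (ε n) := by
    refine (ENNReal.le_sub_of_add_le_left (hetop _) (hstep n hn)).trans ?_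
    rw [tsub_le_iff_right, add_right_comm, tsub_add_cancel_of_le (hanti n.le_succ)]
  calc b n = C⁻¹ * (C * b n) := by
        rw [← mul_assoc, ENNReal.inv_mul_cancel hC0 hCtop, one_mul]
    _ ≤ _ := mul_le_mul_right h1 _

end Asymptotics

/-! ### Almost sure limit of the conditional probabilities -/

section Limit

variable {𝕏 Ω : Type*} [MetricSpace 𝕏] [CompactSpace 𝕏] [MeasurableSpace 𝕏] [BorelSpace 𝕏]
  [MeasurableSpace Ω] {P : Measure Ω} [IsProbabilityMeasure P] {μ : Measure 𝕏} [IsFiniteMeasure μ]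
  {T : ℝ} {τ : 𝕏 → ℝ} {ξ : Ω → C(𝕏, ℝ)} {U : ℕ → Ω → ℝ} {X : ℕ → Ω → 𝕏}

/-- Lévy's upward theorem for the conditional probability of `ξ(u) ≥ T`. -/
lemma exists_tendsto_postProb (hdes : IsSequentialDesign τ ξ U X) (hτ : Continuous τ)
    (hξ : Measurable ξ) (hU : ∀ n, Measurable (U n)) (u : 𝕏) :
    ∃ p : Ω → ℝ, Measurable p ∧
      ∀ᵐ ω ∂P, Tendsto (fun n => postProb P τ ξ U X T n ω u) atTop (𝓝 (p ω)) := by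
  let ℱ := obsFiltration hdes hτ hξ hU
  have hA : MeasurableSet {f : C(𝕏, ℝ) | u ∈ excursionSet T f} :=
    measurableSet_setOf_mem_excursionSet T u
  let w : Ω → ℝ := (ξ ⁻¹' {f : C(𝕏, ℝ) | u ∈ excursionSet T f}).indicator fun _ => (1 : ℝ)
  refine ⟨P[w | ⨆ n, ℱ n], (stronglyMeasurable_condExp.mono (iSup_le fun n => ℱ.le n)).measurable,
    ?_⟩
  have hpost : ∀ᵐ ω ∂P, ∀ n, postProb P τ ξ U X T n ω u = (P[w | ℱ n]) ω := by
    refine ae_all_iff.2 fun n => ?_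
    exact condDistrib_ae_eq_condExp (measurable_history hdes hτ hξ fun i _ => hU i) hξ hA
  filter_upwards [hpost, tendsto_ae_condExp (ℱ := ℱ) (μ := P) w] with ω h1 h2
  simpa only [h1] using h2

/-- For almost every `u`, the conditional probability of `ξ(u) ≥ T` converges almost surely to the
indicator of this event. -/
lemma ae_ae_tendsto_residual (hτ : Continuous τ) (hξ : Measurable ξ)
    (hU : ∀ n, Measurable (U n)) (hU_law : ∀ n, HasLaw (U n) (gaussianReal 0 1) P)
    (hU_indep : iIndepFun U P) (hξU : IndepFun ξ (fun ω n => U n ω) P)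
    (hX : IsQuasiSUR P τ ξ U (bernoulliVariance μ T) X) :
    ∀ᵐ u ∂μ, ∀ᵐ ω ∂P, Tendsto (fun n => residual P τ ξ U X T n (ω, u)) atTop (𝓝 0) := by
  have hdes := hX.1
  have hh : ∀ n, Measurable (history τ ξ U X n) := fun n =>
    measurable_history hdes hτ hξ fun i _ => hU i
  have hξx : ∀ x, Measurable fun ω => ξ ω x := fun x => (measurable_eval_const x).comp hξ
  choose p hp hlim using exists_tendsto_postProb (P := P) (T := T) hdes hτ hξ hU
  let w : 𝕏 → Ω → ℝ := fun u ω => (excursionSet T (ξ ω)).indicator (fun _ => (1 : ℝ)) u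
  let R : 𝕏 → 𝕏 → ℝ → ℂ := fun u x t =>
    ∫ ω, ((w u ω - p u ω : ℝ) : ℂ) * Complex.exp (t * ξ ω x * Complex.I) ∂P
  have hw : ∀ u, Measurable (w u) := fun u =>
    (measurable_indicator_excursionSet hξ).comp measurable_prodMk_right
  have hres : ∀ u, ∀ᵐ ω ∂P, Tendsto (fun n => residual P τ ξ U X T n (ω, u)) atTop
      (𝓝 (w u ω - p u ω)) := fun u => by
    filter_upwards [hlim u] with ω hω using tendsto_const_nhds.sub hω
  have hbd : ∀ u, ∀ᵐ ω ∂P, |w u ω - p u ω| ≤ 1 := fun u => by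
    filter_upwards [hres u] with ω hω
    exact le_of_tendsto hω.abs (Eventually.of_forall fun n => abs_residual_le_one n (ω, u))
  have hexpm : ∀ x (t : ℝ), Measurable fun ω => Complex.exp (t * ξ ω x * Complex.I) := fun x t =>
    Complex.measurable_exp.comp
      (((Complex.measurable_ofReal.comp (hξx x)).const_mul _).mul_const _)
  have hR : ∀ u x t, Tendsto (fun n => residualCov P τ ξ U X T n u x t) atTop (𝓝 (R u x t)) := by
    intro u x t
    refine tendsto_integral_of_dominated_convergence (fun _ => 1) (fun n => ?_)
      (integrable_const _) (fun n => ae_of_all _ fun ω => ?_) ?_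
    · exact ((Complex.measurable_ofReal.comp ((measurable_residual hξ hh n).comp
        measurable_prodMk_right)).mul (hexpm x t)).aestronglyMeasurable
    · rw [norm_mul, norm_exp_mul_mul_I, mul_one, Complex.norm_real]
      exact abs_residual_le_one n (ω, u)
    · filter_upwards [hres u] with ω hω
      exact ((Complex.continuous_ofReal.tendsto _).comp hω).mul_const _
  -- Vanishing at one fixed observation point, by Fatou's lemma.
  have hzero : ∀ x t, ∀ᵐ u ∂μ, R u x t = 0 := by
    intro x t
    have hm : ∀ n, Measurable fun u => ‖residualCov P τ ξ U X T n u x t‖ₑ ^ 2 := fun n =>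
      (measurable_residualCov hξ hh n x t).enorm.pow_const 2
    have hlim2 : ∀ u, Tendsto (fun n => ‖residualCov P τ ξ U X T n u x t‖ₑ ^ 2) atTop
        (𝓝 (‖R u x t‖ₑ ^ 2)) := fun u =>
      ((ENNReal.continuous_pow 2).tendsto _).comp (hR u x t).enorm
    have hmR : Measurable fun u => ‖R u x t‖ₑ ^ 2 :=
      measurable_of_tendsto_metrizable hm (tendsto_pi_nhds.2 hlim2)
    have hF : ∫⁻ u, ‖R u x t‖ₑ ^ 2 ∂μ ≤ 0 := by
      have h := lintegral_liminf_le (μ := μ) (u := atTop) hm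
      rw [(tendsto_lintegral_residualCov hτ hξ hU hU_law hU_indep hξU hX x t).liminf_eq] at h
      simpa only [(hlim2 _).liminf_eq] using h
    filter_upwards [(lintegral_eq_zero_iff hmR).1 (le_antisymm hF zero_le)] with u hu
    simpa using hu
  -- The exceptional null set can be chosen independently of the observation point, by continuity.
  have hcont : ∀ u, Continuous fun q : 𝕏 × ℝ => R u q.1 q.2 := by
    intro u
    refine continuous_of_dominated (bound := fun _ => 1) (fun q => ?_) (fun q => ?_)
      (integrable_const _) (ae_of_all _ fun ω => ?_)
    · exact ((Complex.measurable_ofReal.comp ((hw u).sub (hp u))).mul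
        (hexpm q.1 q.2)).aestronglyMeasurable
    · filter_upwards [hbd u] with ω hω
      rw [norm_mul, norm_exp_mul_mul_I, mul_one, Complex.norm_real]
      exact hω
    · have : Continuous fun q : 𝕏 × ℝ => ξ ω q.1 := (ξ ω).continuous.comp continuous_fst
      fun_prop
  obtain ⟨D, hDc, hD⟩ := TopologicalSpace.exists_countable_dense (𝕏 × ℝ)
  have hall : ∀ᵐ u ∂μ, ∀ q ∈ D, R u q.1 q.2 = 0 := (ae_ball_iff hDc).2 fun q _ => hzero q.1 q.2
  filter_upwards [hall] with u hu
  -- This allows the observation point to be `u` itself.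
  have hRu : ∀ t, R u u t = 0 := fun t =>
    congrFun (Continuous.ext_on hD (hcont u) continuous_const fun q hq => hu q hq) (u, t)
  have hp01 : ∀ᵐ ω ∂P, 0 ≤ p u ω ∧ p u ω ≤ 1 := by
    filter_upwards [hlim u] with ω hω
    exact ⟨ge_of_tendsto hω (Eventually.of_forall fun n => postProb_nonneg n ω u),
      le_of_tendsto hω (Eventually.of_forall fun n => postProb_le_one n ω u)⟩
  have hpw := ae_eq_indicator_of_forall_integral_exp_eq_zero (hξx u) (measurableSet_Ici (a := T))
    (hp u) (hp01.mono fun _ h => h.1) (hp01.mono fun _ h => h.2) hRu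
  filter_upwards [hres u, hpw] with ω h1 h2
  have h3 : w u ω - p u ω = 0 := sub_eq_zero.2 h2.symm
  rwa [h3] at h1

/-- If `p n` tends to `a ∈ {0, 1}`, thresholding `p n` at `1/2` eventually returns `a` exactly. -/
lemma tendsto_indicator_sub_indicator_of_tendsto {a : ℝ} (ha : a = 0 ∨ a = 1) {p : ℕ → ℝ}
    (h : Tendsto (fun n => a - p n) atTop (𝓝 0)) :
    Tendsto (fun n => a - {q : ℝ | 1 / 2 ≤ q}.indicator (fun _ => (1 : ℝ)) (p n)) atTop (𝓝 0) := by
  have h' : ∀ᶠ n in atTop, |a - p n| < 1 / 2 := by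
    exact h.abs.eventually_lt_const (by norm_num)
  refine tendsto_const_nhds.congr' ?_
  filter_upwards [h'] with n hn
  rw [abs_lt] at hn
  rcases ha with rfl | rfl
  · rw [Set.indicator_of_notMem (by simp only [Set.mem_ofPred_eq]; linarith)]; simp
  · rw [Set.indicator_of_mem (by simp only [Set.mem_ofPred_eq]; linarith)]; simp

end Limit

end SUR

theorem mainTheorem6 {𝕏 Ω : Type*} [MetricSpace 𝕏] [CompactSpace 𝕏] [MeasurableSpace 𝕏]
    [BorelSpace 𝕏] [MeasurableSpace Ω] (P : Measure Ω) [IsProbabilityMeasure P]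
    (μ : Measure 𝕏) [IsFiniteMeasure μ] (T : ℝ)
    (τ : 𝕏 → ℝ) (hτ : Continuous τ) (hτ_nonneg : ∀ x, 0 ≤ τ x)
    (ξ : Ω → C(𝕏, ℝ)) (hξ_meas : ∀ x, Measurable (fun ω => ξ ω x))
    (hξ : IsGaussianProcess (fun x ω => ξ ω x) P)
    (U : ℕ → Ω → ℝ) (hU_meas : ∀ n, Measurable (U n))
    (hU_law : ∀ n, HasLaw (U n) (gaussianReal 0 1) P) (hU_indep : iIndepFun U P)
    (hξU : IndepFun ξ (fun ω n => U n ω) P)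
    (X : ℕ → Ω → 𝕏) (hX : SUR.IsQuasiSUR P τ ξ U (SUR.bernoulliVariance μ T) X) :
    SUR.TendstoZeroAEAndL1 P (SUR.softError P μ τ ξ U X T) ∧
      SUR.TendstoZeroAEAndL1 P (SUR.plugInError P μ τ ξ U X T) := by
  have hξm : Measurable ξ := SUR.measurable_of_measurable_eval hξ_meas
  have hh : ∀ n, Measurable (SUR.history τ ξ U X n) := fun n =>
    SUR.measurable_history hX.1 hτ hξm fun i _ => hU_meas i
  have hR : ∀ n, Measurable (SUR.residual P τ ξ U X T n) := SUR.measurable_residual hξm hh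
  have hlim : ∀ᵐ ω ∂P, ∀ᵐ u ∂μ,
      Tendsto (fun n => SUR.residual P τ ξ U X T n (ω, u)) atTop (𝓝 0) := by
    refine (Measure.ae_ae_comm ?_).1
      (SUR.ae_ae_tendsto_residual hτ hξm hU_meas hU_law hU_indep hξU hX)
    exact measurableSet_tendsto (𝓝 0) fun n => (hR n).comp measurable_swap
  have hS : MeasurableSet {q : ℝ | 1 / 2 ≤ q} := measurableSet_Ici
  let D : ℕ → Ω × 𝕏 → ℝ := fun n q =>
    (SUR.excursionSet T (ξ q.1)).indicator (fun _ => (1 : ℝ)) q.2 -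
      {v : ℝ | 1 / 2 ≤ v}.indicator (fun _ => (1 : ℝ)) (SUR.postProb P τ ξ U X T n q.1 q.2)
  have hsoft : SUR.softError P μ τ ξ U X T =
      fun n ω => ∫ u, SUR.residual P τ ξ U X T n (ω, u) ^ 2 ∂μ := rfl
  have hplug : SUR.plugInError P μ τ ξ U X T = fun n ω => ∫ u, D n (ω, u) ^ 2 ∂μ := rfl
  rw [hsoft, hplug]
  refine ⟨SUR.tendstoZeroAEAndL1_integral_sq hR SUR.abs_residual_le_one hlim,
    SUR.tendstoZeroAEAndL1_integral_sq (fun n => ?_) (fun n q => ?_) ?_⟩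
  · exact (SUR.measurable_indicator_excursionSet hξm).sub
      ((measurable_const.indicator hS).comp (SUR.measurable_postProb hh n))
  · simp only [D]
    by_cases h1 : q.2 ∈ SUR.excursionSet T (ξ q.1) <;>
      by_cases h2 : SUR.postProb P τ ξ U X T n q.1 q.2 ∈ {v : ℝ | 1 / 2 ≤ v} <;>
      simp only [h1, h2, Set.indicator_of_mem, Set.indicator_of_notMem, not_false_eq_true] <;>
      norm_num
  · filter_upwards [hlim] with ω hω
    filter_upwards [hω] with u hu
    refine SUR.tendsto_indicator_sub_indicator_of_tendsto ?_ hu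
    by_cases h : u ∈ SUR.excursionSet T (ξ ω) <;> simp [h]
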